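/- Let $m,n,p,q$ be nonnegative integers, $A\in\mathbb C^{m\times n}$, $B\in\mathbb C^{m\times p}$, $C\in\mathbb C^{q\times n}$, and let $t$ be an integer with $0\le t\le\min\{p,q\}$. Write $r(\cdot)$ for the rank of a matrix, $\mathbb C_t^{a\times b}$ for the set of complex $a\times b$ matrices of rank exactly $t$, and put $$G=[\,A,\ B\,],\qquad H=\begin{bmatrix}A\\ C\end{bmatrix},\qquad M=\begin{bmatrix}A&B\\ C&0\end{bmatrix}.$$ Then the following maximum and minimum are attained and equal $$\max_{Y\in\mathbb C_t^{p\times t},\ Z\in\mathbb C_t^{t\times q}} r(A+BYZC)=\min\{\,r(G),\ r(H),\ r(A)+t\,\},$$ $$\min_{Y\in\mathbb C_t^{p\times t},\ Z\in\mathbb C_t^{t\times q}} r(A+BYZC)=\max\{\,r(G)+r(H)-r(M),\ r(G)+r(H)-r(A)+t-p-q,\ r(A)-t\,\}.$$ -/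

import Mathlib

/-- The set of complex `p × q` matrices of rank exactly `t`. -/
def fixedRankMatrices (p q t : ℕ) : Set (Matrix (Fin p) (Fin q) ℂ) :=
  {X | X.rank = t}

/-- The row block matrix `[A, B]`. -/
def blockG {m n p : ℕ} (A : Matrix (Fin m) (Fin n) ℂ) (B : Matrix (Fin m) (Fin p) ℂ) :
    Matrix (Fin m) (Fin n ⊕ Fin p) ℂ :=
  Matrix.fromCols A B

/-- The column block matrix with `A` above `C`. -/
def blockH {m n q : ℕ} (A : Matrix (Fin m) (Fin n) ℂ) (C : Matrix (Fin q) (Fin n) ℂ) :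
    Matrix (Fin m ⊕ Fin q) (Fin n) ℂ :=
  Matrix.fromRows A C

/-- The block matrix with first block row `A, B` and second block row `C, 0`. -/
def blockM {m n p q : ℕ} (A : Matrix (Fin m) (Fin n) ℂ) (B : Matrix (Fin m) (Fin p) ℂ)
    (C : Matrix (Fin q) (Fin n) ℂ) : Matrix (Fin m ⊕ Fin q) (Fin n ⊕ Fin p) ℂ :=
  Matrix.fromBlocks A B C 0

/-- The set of values (as integers) of `rank (A + B * Y * Z * C)` when `Y` and `Z` run over the
`p × t` and `t × q` matrices of rank `t`. -/
def factoredRankValues {m n p q : ℕ} (A : Matrix (Fin m) (Fin n) ℂ)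
    (B : Matrix (Fin m) (Fin p) ℂ) (C : Matrix (Fin q) (Fin n) ℂ) (t : ℕ) : Set ℤ :=
  {k | ∃ Y ∈ fixedRankMatrices p t t, ∃ Z ∈ fixedRankMatrices t q t,
    k = ((A + B * Y * Z * C).rank : ℤ)}

open Module Matrix
set_option linter.unusedSectionVars false

/-! ### Rank-one updates. -/

section RankOneUpdates

variable {K : Type*} [Field K] {l m n o p q : Type*} [Fintype l] [Fintype m] [Fintype n]
  [Fintype o] [Fintype p] [Fintype q]

/-! By full-rank factorization, `Y * Z` runs over exactly the `p × q` matrices `X` of rank `t`. Put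
N = A + BXC. Replacing A by N leaves r(G), r(H) and r(M) unchanged, so any rank inequality for A, G,
H, M also holds for N. This gives the bounds free of `t`; subadditivity of rank gives r(A) ± t, and
Frobenius' inequality applied to N = [I, BY] diag(A, I) [I; ZC] gives the bound with p + q.

Both extrema are reached by building X from rank-one terms. For the maximum, while r(N) < r(G) and
r(N) < r(H), some Bu and Cᵀv lie outside the column and row spaces of N, and adding their product
raises r(N). Further terms, suitably scaled, bring r(X) up to `t` without lowering r(N).

For the minimum, while r(G) + r(H) < r(N) + r(M), a Wedderburn step (`exists_rank_add_vecMulVec_lt`)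
lowers r(N). The remaining steps use directions u with Bu ∈ A(ker C), or their transposed analogues,
which never raise r(N). They number r(H) + p - r(M) and r(G) + q - r(M), and
`exists_rank_eq_add_of_free_directions` shows that each pays for one step; only the excess costs
rank, which produces the p + q term. -/

theorem exists_dotProduct_ne_zero_of_notMem {S : Submodule K (m → K)} {w : m → K} (hw : w ∉ S) :
    ∃ y : m → K, (∀ x ∈ S, y ⬝ᵥ x = 0) ∧ y ⬝ᵥ w ≠ 0 := by
  classical
  obtain ⟨f, hf, hS⟩ := S.exists_le_ker_of_notMem hw
  have key : ∀ x, (dotProductEquiv K m).symm f ⬝ᵥ x = f x := fun x => by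
    conv_rhs => rw [← (dotProductEquiv K m).apply_symm_apply f]
    rfl
  exact ⟨(dotProductEquiv K m).symm f, fun x hx => by rw [key]; exact hS hx, by rwa [key]⟩

theorem dotProduct_mulVec_eq_transpose (X : Matrix m n K) (y : m → K) (x : n → K) :
    y ⬝ᵥ X *ᵥ x = Xᵀ *ᵥ y ⬝ᵥ x := by
  rw [dotProduct_mulVec, mulVec_transpose]

theorem exists_mulVec_eq_zero_of_notMem_range_transpose {X : Matrix m n K} {v : n → K}
    (hv : v ∉ LinearMap.range Xᵀ.mulVecLin) : ∃ x, X *ᵥ x = 0 ∧ v ⬝ᵥ x ≠ 0 := by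
  obtain ⟨x, hx, hvx⟩ := exists_dotProduct_ne_zero_of_notMem hv
  refine ⟨x, dotProduct_eq_zero _ fun y => ?_, by rwa [dotProduct_comm]⟩
  rw [dotProduct_comm, dotProduct_mulVec_eq_transpose, dotProduct_comm]
  exact hx _ ⟨y, rfl⟩

theorem mem_range_transpose_of_forall {X : Matrix m n K} {v : n → K}
    (h : ∀ x, X *ᵥ x = 0 → v ⬝ᵥ x = 0) : v ∈ LinearMap.range Xᵀ.mulVecLin := by
  by_contra hv
  obtain ⟨x, hx, hvx⟩ := exists_mulVec_eq_zero_of_notMem_range_transpose hv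
  exact hvx (h x hx)

theorem add_vecMulVec_mulVec (X : Matrix m n K) (u : m → K) (v x : n → K) :
    (X + vecMulVec u v) *ᵥ x = X *ᵥ x + (v ⬝ᵥ x) • u := by
  rw [add_mulVec, vecMulVec_mulVec]
  simp

theorem range_add_vecMulVec_le (X : Matrix m n K) (u : m → K) (v : n → K) :
    LinearMap.range (X + vecMulVec u v).mulVecLin ≤
      LinearMap.range X.mulVecLin ⊔ Submodule.span K {u} := by
  rintro _ ⟨x, rfl⟩
  rw [mulVecLin_apply, add_vecMulVec_mulVec]
  exact Submodule.add_mem_sup ⟨x, rfl⟩ (Submodule.smul_mem _ _ (Submodule.mem_span_singleton_self u))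

/-- Some kernel vector of `X` pairs nontrivially with `v`, so the update reaches `u` itself. -/
theorem range_add_vecMulVec {X : Matrix m n K} (u : m → K) {v : n → K}
    (hv : v ∉ LinearMap.range Xᵀ.mulVecLin) :
    LinearMap.range (X + vecMulVec u v).mulVecLin =
      LinearMap.range X.mulVecLin ⊔ Submodule.span K {u} := by
  refine le_antisymm (range_add_vecMulVec_le X u v) ?_
  obtain ⟨x₀, hx₀, hvx⟩ := exists_mulVec_eq_zero_of_notMem_range_transpose hv
  have hu : u ∈ LinearMap.range (X + vecMulVec u v).mulVecLin :=
    ⟨(v ⬝ᵥ x₀)⁻¹ • x₀, by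
      rw [mulVecLin_apply, mulVec_smul, add_vecMulVec_mulVec, hx₀, zero_add, smul_smul,
        inv_mul_cancel₀ hvx, one_smul]⟩
  refine sup_le ?_ ((Submodule.span_singleton_le_iff_mem _ _).2 hu)
  rintro _ ⟨x, rfl⟩
  have h : X *ᵥ x = (X + vecMulVec u v) *ᵥ x - (v ⬝ᵥ x) • u := by
    rw [add_vecMulVec_mulVec, add_sub_cancel_right]
  rw [mulVecLin_apply, h]
  exact Submodule.sub_mem _ ⟨x, rfl⟩ (Submodule.smul_mem _ _ hu)

theorem transpose_add_vecMulVec (X : Matrix m n K) (u : m → K) (v : n → K) :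
    (X + vecMulVec u v)ᵀ = Xᵀ + vecMulVec v u := by
  rw [transpose_add, transpose_vecMulVec]

theorem rank_eq_finrank_range (X : Matrix m n K) :
    X.rank = finrank K (LinearMap.range X.mulVecLin) := rfl

theorem finrank_sup_span_singleton {V : Type*} [AddCommGroup V] [Module K V]
    [FiniteDimensional K V] {S : Submodule K V} {u : V} (hu : u ∉ S) :
    finrank K ↥(S ⊔ Submodule.span K {u}) = finrank K S + 1 := by
  have h := Submodule.finrank_sup_add_finrank_inf_eq S (Submodule.span K {u})
  have h0 : u ≠ 0 := fun h => hu (h ▸ S.zero_mem)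
  have hd : S ⊓ Submodule.span K {u} = ⊥ :=
    ((Submodule.disjoint_span_singleton' h0).2 hu).eq_bot
  rw [hd, finrank_bot, finrank_span_singleton h0] at h
  simpa using h

theorem finrank_sup_span_singleton_le {V : Type*} [AddCommGroup V] [Module K V]
    [FiniteDimensional K V] (S : Submodule K V) (u : V) :
    finrank K ↥(S ⊔ Submodule.span K {u}) ≤ finrank K S + 1 :=
  (Submodule.finrank_add_le_finrank_add_finrank _ _).trans
    (Nat.add_le_add_left (finrank_span_le_card ({u} : Set V) |>.trans (by simp)) _)

theorem rank_add_vecMulVec_le (X : Matrix m n K) (u : m → K) (v : n → K) :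
    (X + vecMulVec u v).rank ≤ X.rank + 1 :=
  (Submodule.finrank_mono (range_add_vecMulVec_le X u v)).trans (finrank_sup_span_singleton_le _ _)

theorem rank_add_vecMulVec {X : Matrix m n K} {u : m → K} {v : n → K}
    (hu : u ∉ LinearMap.range X.mulVecLin) (hv : v ∉ LinearMap.range Xᵀ.mulVecLin) :
    (X + vecMulVec u v).rank = X.rank + 1 := by
  rw [rank_eq_finrank_range, range_add_vecMulVec u hv, finrank_sup_span_singleton hu,
    rank_eq_finrank_range]

theorem rank_add_vecMulVec_le_of_mem {X : Matrix m n K} {u : m → K} {v : n → K}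
    (hu : u ∈ LinearMap.range X.mulVecLin) : (X + vecMulVec u v).rank ≤ X.rank :=
  Submodule.finrank_mono ((range_add_vecMulVec_le X u v).trans
    (sup_le le_rfl ((Submodule.span_singleton_le_iff_mem _ _).2 hu)))

theorem rank_add_vecMulVec_le_of_mem_transpose {X : Matrix m n K} {u : m → K} {v : n → K}
    (hv : v ∈ LinearMap.range Xᵀ.mulVecLin) : (X + vecMulVec u v).rank ≤ X.rank := by
  rw [← rank_transpose, ← rank_transpose X, transpose_add_vecMulVec]
  exact rank_add_vecMulVec_le_of_mem hv

theorem rank_le_rank_add_vecMulVec_of_notMem_transpose {X : Matrix m n K} (u : m → K) {v : n → K}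
    (hv : v ∉ LinearMap.range Xᵀ.mulVecLin) : X.rank ≤ (X + vecMulVec u v).rank :=
  Submodule.finrank_mono ((range_add_vecMulVec u hv).symm ▸ le_sup_left)

theorem rank_le_rank_add_vecMulVec_of_notMem {X : Matrix m n K} {u : m → K} (v : n → K)
    (hu : u ∉ LinearMap.range X.mulVecLin) : X.rank ≤ (X + vecMulVec u v).rank := by
  rw [← rank_transpose, ← rank_transpose (X + _), transpose_add_vecMulVec]
  exact rank_le_rank_add_vecMulVec_of_notMem_transpose v (by rwa [transpose_transpose])

/-- If u = Xx, the update is X(1 + c x vᵀ), and the second factor has determinant 1 + c(v · x). This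
cannot vanish at both c = 1 and c = 2. -/
theorem exists_smul_rank_le_rank_add_vecMulVec [CharZero K] (X : Matrix m n K) (u : m → K)
    (v : n → K) : ∃ c : K, c ≠ 0 ∧ X.rank ≤ (X + vecMulVec (c • u) v).rank := by
  classical
  by_cases hu : u ∈ LinearMap.range X.mulVecLin
  swap
  · exact ⟨1, one_ne_zero, rank_le_rank_add_vecMulVec_of_notMem v (by rwa [one_smul])⟩
  obtain ⟨x, rfl⟩ := hu
  obtain ⟨c, hc, hdet⟩ : ∃ c : K, c ≠ 0 ∧ 1 + c * (v ⬝ᵥ x) ≠ 0 := by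
    by_cases h : 1 + v ⬝ᵥ x = 0
    · refine ⟨2, two_ne_zero, fun h2 => one_ne_zero (α := K) ?_⟩
      linear_combination 2 * h - h2
    · exact ⟨1, one_ne_zero, by rwa [one_mul]⟩
  refine ⟨c, hc, ?_⟩
  have hX : X + vecMulVec (c • X.mulVecLin x) v = X * (1 + vecMulVec (c • x) v) := by
    rw [Matrix.mul_add, Matrix.mul_one, mul_vecMulVec, mulVecLin_apply, mulVec_smul]
  have hdet' : IsUnit (1 + vecMulVec (c • x) v).det := by
    rw [vecMulVec_eq Unit, det_one_add_replicateCol_mul_replicateRow, dotProduct_smul,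
      smul_eq_mul]
    exact hdet.isUnit
  rw [hX, rank_mul_eq_left_of_isUnit_det _ _ hdet']

/-! ### Frobenius' inequality and the rank of a row block matrix. -/

theorem finrank_map_add_finrank_ker_inf {V W : Type*} [AddCommGroup V] [Module K V]
    [AddCommGroup W] [Module K W] [FiniteDimensional K V] (f : V →ₗ[K] W) (S : Submodule K V) :
    finrank K (S.map f) + finrank K ↥(LinearMap.ker f ⊓ S) = finrank K S := by
  have h := (f.domRestrict S).finrank_range_add_finrank_ker
  rw [LinearMap.range_domRestrict, LinearMap.ker_domRestrict] at h
  rw [← h, inf_comm, ← Submodule.map_comap_subtype, Submodule.finrank_map_subtype_eq]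

/-- Multiplying by `P` loses ker P ∩ range Q from `Q`, and only a subspace of that from `Q * R`. -/
theorem rank_mul_add_rank_mul_le (P : Matrix l m K) (Q : Matrix m n K) (R : Matrix n o K) :
    (P * Q).rank + (Q * R).rank ≤ (P * Q * R).rank + Q.rank := by
  have h1 := finrank_map_add_finrank_ker_inf P.mulVecLin (LinearMap.range Q.mulVecLin)
  have h2 := finrank_map_add_finrank_ker_inf P.mulVecLin (LinearMap.range (Q * R).mulVecLin)
  rw [← LinearMap.range_comp, ← mulVecLin_mul] at h1 h2
  have hle : LinearMap.range (Q * R).mulVecLin ≤ LinearMap.range Q.mulVecLin := by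
    rw [mulVecLin_mul]
    exact LinearMap.range_comp_le_range _ _
  have h3 := Submodule.finrank_mono (inf_le_inf_left (LinearMap.ker P.mulVecLin) hle)
  rw [Matrix.mul_assoc]
  simp only [rank_eq_finrank_range]
  omega

theorem range_fromCols (X : Matrix m n K) (Y : Matrix m p K) :
    LinearMap.range (fromCols X Y).mulVecLin =
      LinearMap.range X.mulVecLin ⊔ LinearMap.range Y.mulVecLin := by
  refine le_antisymm ?_ (sup_le ?_ ?_)
  · rintro _ ⟨x, rfl⟩
    rw [mulVecLin_apply, fromCols_mulVec]
    exact Submodule.add_mem_sup ⟨_, rfl⟩ ⟨_, rfl⟩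
  · rintro _ ⟨x, rfl⟩
    exact ⟨Sum.elim x 0, by simp [fromCols_mulVec]⟩
  · rintro _ ⟨x, rfl⟩
    exact ⟨Sum.elim 0 x, by simp [fromCols_mulVec]⟩

theorem rank_fromCols_add_finrank_comap (X : Matrix m n K) (Y : Matrix m p K) :
    (fromCols X Y).rank + finrank K ((LinearMap.range X.mulVecLin).comap Y.mulVecLin) =
      X.rank + Fintype.card p := by
  have h1 := finrank_map_add_finrank_ker_inf Y.mulVecLin
    ((LinearMap.range X.mulVecLin).comap Y.mulVecLin)
  rw [Submodule.map_comap_eq, inf_eq_left.2 (LinearMap.ker_le_comap _)] at h1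
  have h2 := Submodule.finrank_sup_add_finrank_inf_eq (LinearMap.range X.mulVecLin)
    (LinearMap.range Y.mulVecLin)
  have h3 := Y.mulVecLin.finrank_range_add_finrank_ker
  rw [inf_comm] at h2
  rw [finrank_fintype_fun_eq_card] at h3
  rw [rank_eq_finrank_range, rank_eq_finrank_range, range_fromCols]
  omega

theorem rank_fromCols_le (X : Matrix m n K) (Y : Matrix m p K) :
    (fromCols X Y).rank ≤ X.rank + Fintype.card p := by
  have := rank_fromCols_add_finrank_comap X Y
  omega

end RankOneUpdates

/-! ### Free directions and the invariance of r(G), r(H), r(M). -/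

section Compression

variable {K : Type*} [Field K] {m n p q : Type*} [Fintype m] [Fintype n] [Fintype p] [Fintype q]

/-- The vectors `u` with `B u ∈ A (ker C)`. -/
def freeDirections (A : Matrix m n K) (B : Matrix m p K) (C : Matrix q n K) :
    Submodule K (p → K) :=
  ((LinearMap.ker C.mulVecLin).map A.mulVecLin).comap B.mulVecLin

/-- Split M as [H, (B; 0)]: the free directions are the preimage of range H under (B; 0). -/
theorem rank_fromBlocks_add_finrank_freeDirections (A : Matrix m n K) (B : Matrix m p K)
    (C : Matrix q n K) :
    (fromBlocks A B C 0).rank + finrank K (freeDirections A B C) =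
      (fromRows A C).rank + Fintype.card p := by
  have h := rank_fromCols_add_finrank_comap (fromRows A C) (fromRows B (0 : Matrix q p K))
  rw [fromCols_fromRows_eq_fromBlocks] at h
  suffices hcomap : freeDirections A B C =
      (LinearMap.range (fromRows A C).mulVecLin).comap (fromRows B (0 : Matrix q p K)).mulVecLin by
    rw [← h, hcomap]
  ext u
  simp only [freeDirections, Submodule.mem_comap, Submodule.mem_map, LinearMap.mem_ker,
    LinearMap.mem_range, mulVecLin_apply, fromRows_mulVec, zero_mulVec, Sum.elim_eq_iff]
  exact ⟨fun ⟨x, hC, hA⟩ => ⟨x, hA, hC⟩, fun ⟨x, hA, hC⟩ => ⟨x, hC, hA⟩⟩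

theorem rank_fromBlocks_transpose (A : Matrix m n K) (B : Matrix m p K) (C : Matrix q n K) :
    (fromBlocks Aᵀ Cᵀ Bᵀ 0).rank = (fromBlocks A B C 0).rank := by
  rw [← rank_transpose (fromBlocks A B C 0), fromBlocks_transpose, transpose_zero]

theorem rank_fromRows_transpose (A : Matrix m n K) (B : Matrix m p K) :
    (fromRows Aᵀ Bᵀ).rank = (fromCols A B).rank := by
  rw [← rank_transpose, transpose_fromRows, transpose_transpose, transpose_transpose]

theorem rank_fromCols_transpose (A : Matrix m n K) (C : Matrix q n K) :
    (fromCols Aᵀ Cᵀ).rank = (fromRows A C).rank := by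
  rw [← rank_transpose, transpose_fromCols, transpose_transpose, transpose_transpose]

theorem rank_fromBlocks_add_finrank_freeDirections_transpose (A : Matrix m n K)
    (B : Matrix m p K) (C : Matrix q n K) :
    (fromBlocks A B C 0).rank + finrank K (freeDirections Aᵀ Cᵀ Bᵀ) =
      (fromCols A B).rank + Fintype.card q := by
  rw [← rank_fromBlocks_transpose, rank_fromBlocks_add_finrank_freeDirections,
    rank_fromRows_transpose]

theorem freeDirections_le_comap_range (A : Matrix m n K) (B : Matrix m p K) (C : Matrix q n K) :
    freeDirections A B C ≤ (LinearMap.range A.mulVecLin).comap B.mulVecLin :=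
  Submodule.comap_mono LinearMap.map_le_range

theorem freeDirections_add_mul_mul (A : Matrix m n K) (B : Matrix m p K) (C : Matrix q n K)
    (X : Matrix p q K) : freeDirections (A + B * X * C) B C = freeDirections A B C := by
  ext u
  simp only [freeDirections, Submodule.mem_comap, Submodule.mem_map, LinearMap.mem_ker,
    mulVecLin_apply]
  refine exists_congr fun x => and_congr_right fun hx => ?_
  rw [add_mulVec, ← mulVec_mulVec, hx, mulVec_zero, add_zero]

theorem add_mul_mul_transpose (A : Matrix m n K) (B : Matrix m p K) (C : Matrix q n K)
    (X : Matrix p q K) : (A + B * X * C)ᵀ = Aᵀ + Cᵀ * Xᵀ * Bᵀ := by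
  simp only [transpose_add, transpose_mul, Matrix.mul_assoc]

theorem rank_fromCols_add_mul_mul_le (A : Matrix m n K) (B : Matrix m p K) (C : Matrix q n K)
    (X : Matrix p q K) : (fromCols (A + B * X * C) B).rank ≤ (fromCols A B).rank := by
  refine Submodule.finrank_mono ?_
  rw [range_fromCols, range_fromCols]
  refine sup_le ?_ le_sup_right
  rintro _ ⟨x, rfl⟩
  rw [mulVecLin_apply, add_mulVec, Matrix.mul_assoc, ← mulVec_mulVec]
  exact Submodule.add_mem_sup ⟨_, rfl⟩ ⟨_, rfl⟩

theorem rank_fromCols_add_mul_mul (A : Matrix m n K) (B : Matrix m p K) (C : Matrix q n K)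
    (X : Matrix p q K) : (fromCols (A + B * X * C) B).rank = (fromCols A B).rank := by
  refine le_antisymm (rank_fromCols_add_mul_mul_le A B C X) ?_
  have h := rank_fromCols_add_mul_mul_le (A + B * X * C) B C (-X)
  rwa [Matrix.mul_neg, Matrix.neg_mul, add_neg_cancel_right] at h

theorem rank_fromRows_add_mul_mul (A : Matrix m n K) (B : Matrix m p K) (C : Matrix q n K)
    (X : Matrix p q K) : (fromRows (A + B * X * C) C).rank = (fromRows A C).rank := by
  rw [← rank_fromCols_transpose, add_mul_mul_transpose, rank_fromCols_add_mul_mul,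
    rank_fromCols_transpose]

theorem rank_fromBlocks_add_mul_mul (A : Matrix m n K) (B : Matrix m p K) (C : Matrix q n K)
    (X : Matrix p q K) :
    (fromBlocks (A + B * X * C) B C 0).rank = (fromBlocks A B C 0).rank := by
  have h1 := rank_fromBlocks_add_finrank_freeDirections A B C
  have h2 := rank_fromBlocks_add_finrank_freeDirections (A + B * X * C) B C
  rw [freeDirections_add_mul_mul, rank_fromRows_add_mul_mul] at h2
  omega

/-! ### Bounds on the rank of A + BXC. -/

theorem rank_le_rank_fromCols (A : Matrix m n K) (B : Matrix m p K) :
    A.rank ≤ (fromCols A B).rank := by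
  refine Submodule.finrank_mono ?_
  rw [range_fromCols]
  exact le_sup_left

theorem rank_le_rank_fromRows (A : Matrix m n K) (C : Matrix q n K) :
    A.rank ≤ (fromRows A C).rank := by
  rw [← rank_transpose A, ← rank_fromCols_transpose]
  exact rank_le_rank_fromCols _ _

/-- The rank bound that does not depend on the rank of the middle factor. -/
theorem rank_fromCols_add_rank_fromRows_le (A : Matrix m n K) (B : Matrix m p K)
    (C : Matrix q n K) :
    (fromCols A B).rank + (fromRows A C).rank ≤ A.rank + (fromBlocks A B C 0).rank := by
  have h1 := rank_fromBlocks_add_finrank_freeDirections A B C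
  have h2 := rank_fromCols_add_finrank_comap A B
  have h3 := Submodule.finrank_mono (freeDirections_le_comap_range A B C)
  omega

theorem rank_add_mul_mul_le (A : Matrix m n K) (B : Matrix m p K) (C : Matrix q n K)
    (X : Matrix p q K) : (A + B * X * C).rank ≤ A.rank + X.rank := by
  have h : (A + B * X * C).rank ≤ (fromCols A (B * X)).rank := by
    refine Submodule.finrank_mono ?_
    rw [range_fromCols]
    rintro _ ⟨x, rfl⟩
    rw [mulVecLin_apply, add_mulVec, ← mulVec_mulVec]
    exact Submodule.add_mem_sup ⟨_, rfl⟩ ⟨_, rfl⟩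
  refine h.trans ?_
  rw [rank_eq_finrank_range, range_fromCols]
  exact (Submodule.finrank_add_le_finrank_add_finrank _ _).trans
    (Nat.add_le_add_left (rank_mul_le_right B X) _)

theorem rank_le_rank_add_mul_mul_add (A : Matrix m n K) (B : Matrix m p K) (C : Matrix q n K)
    (X : Matrix p q K) : A.rank ≤ (A + B * X * C).rank + X.rank := by
  have h := rank_add_mul_mul_le (A + B * X * C) B C (-X)
  have h2 : (-X).rank = X.rank := by
    have : (-X).mulVecLin = -X.mulVecLin := by
      ext x
      simp
    rw [rank_eq_finrank_range, this, LinearMap.range_neg, rank_eq_finrank_range]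
  rwa [Matrix.mul_neg, Matrix.neg_mul, add_neg_cancel_right, h2] at h

/-- `Y` is injective, so pulling the preimage of range A under `B` back along `Y` does not increase
its dimension. -/
theorem rank_fromCols_add_card_le {s : Type*} [Fintype s] (A : Matrix m n K)
    (B : Matrix m p K) {Y : Matrix p s K} (hY : Y.rank = Fintype.card s) :
    (fromCols A B).rank + Fintype.card s ≤ (fromCols A (B * Y)).rank + Fintype.card p := by
  have h1 := rank_fromCols_add_finrank_comap A B
  have h2 := rank_fromCols_add_finrank_comap A (B * Y)
  rw [mulVecLin_mul, Submodule.comap_comp] at h2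
  have h3 := finrank_map_add_finrank_ker_inf Y.mulVecLin
    (((LinearMap.range A.mulVecLin).comap B.mulVecLin).comap Y.mulVecLin)
  have h4 := Y.mulVecLin.finrank_range_add_finrank_ker
  rw [finrank_fintype_fun_eq_card, ← rank_eq_finrank_range] at h4
  have h5 := Submodule.finrank_mono (Submodule.map_comap_le Y.mulVecLin
    ((LinearMap.range A.mulVecLin).comap B.mulVecLin))
  have h6 := Submodule.finrank_mono (inf_le_left : LinearMap.ker Y.mulVecLin ⊓
    ((LinearMap.range A.mulVecLin).comap B.mulVecLin).comap Y.mulVecLin ≤ _)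
  omega

theorem rank_fromRows_add_card_le {s : Type*} [Fintype s] (A : Matrix m n K)
    (C : Matrix q n K) {Z : Matrix s q K} (hZ : Z.rank = Fintype.card s) :
    (fromRows A C).rank + Fintype.card s ≤ (fromRows A (Z * C)).rank + Fintype.card q := by
  rw [← rank_fromCols_transpose, ← rank_fromCols_transpose, transpose_mul]
  exact rank_fromCols_add_card_le _ _ (by rwa [rank_transpose])

theorem rank_fromBlocks_zero_zero_one_le {s : Type*} [Fintype s] [DecidableEq s]
    (A : Matrix m n K) :
    (fromBlocks A 0 0 (1 : Matrix s s K)).rank ≤ A.rank + Fintype.card s := by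
  classical
  rw [← fromCols_fromRows_eq_fromBlocks]
  refine (rank_fromCols_le _ _).trans (Nat.add_le_add_right ?_ _)
  have h : fromRows A (0 : Matrix s n K) = fromRows (1 : Matrix m m K) 0 * A := by
    rw [fromRows_mul, Matrix.one_mul, Matrix.zero_mul]
  rw [h]
  exact rank_mul_le_right _ _

/-- The rank bound in terms of the inner size of the middle factorization. -/
theorem rank_fromCols_add_rank_fromRows_add_le {s : Type*} [Fintype s] (A : Matrix m n K)
    (B : Matrix m p K) (C : Matrix q n K) {Y : Matrix p s K} {Z : Matrix s q K}
    (hY : Y.rank = Fintype.card s) (hZ : Z.rank = Fintype.card s) :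
    (fromCols A B).rank + (fromRows A C).rank + Fintype.card s ≤
      (A + B * Y * Z * C).rank + A.rank + Fintype.card p + Fintype.card q := by
  classical
  have h1 := rank_fromCols_add_card_le A B hY
  have h2 := rank_fromRows_add_card_le A C hZ
  have h3 := rank_fromBlocks_zero_zero_one_le (s := s) A
  have h4 := rank_mul_add_rank_mul_le (fromCols 1 (B * Y)) (fromBlocks A 0 0 (1 : Matrix s s K))
    (fromRows 1 (Z * C))
  rw [fromCols_mul_fromBlocks, fromBlocks_mul_fromRows, fromCols_mul_fromRows] at h4
  simp only [Matrix.one_mul, Matrix.mul_one, Matrix.mul_zero, Matrix.zero_mul, add_zero, zero_add,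
    ← Matrix.mul_assoc] at h4
  omega

/-- Wedderburn's rank reduction. Strictness gives u with Bu in range A but not in A(ker C). A
functional y killing A(ker C) but not Bu has Aᵀy = Cᵀv, so subtracting (Bu)(yᵀA)/(yᵀBu) has the form
BXC. The new range lies in range A and is killed by y, so it misses Bu. -/
theorem exists_rank_add_vecMulVec_lt {A : Matrix m n K} {B : Matrix m p K} {C : Matrix q n K}
    (h : (fromCols A B).rank + (fromRows A C).rank < A.rank + (fromBlocks A B C 0).rank) :
    ∃ (u : p → K) (v : q → K), (A + B * vecMulVec u v * C).rank < A.rank := by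
  obtain ⟨u, ⟨x, hx⟩, hu⟩ : ∃ u ∈ (LinearMap.range A.mulVecLin).comap B.mulVecLin,
      u ∉ freeDirections A B C := by
    by_contra! hle
    have h1 := rank_fromBlocks_add_finrank_freeDirections A B C
    have h2 := rank_fromCols_add_finrank_comap A B
    have h3 := Submodule.finrank_mono (show (LinearMap.range A.mulVecLin).comap B.mulVecLin ≤
      freeDirections A B C from hle)
    omega
  obtain ⟨y, hy, hyu⟩ := exists_dotProduct_ne_zero_of_notMem
    (S := (LinearMap.ker C.mulVecLin).map A.mulVecLin) (w := B *ᵥ u) hu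
  obtain ⟨v, hv⟩ : Aᵀ *ᵥ y ∈ LinearMap.range Cᵀ.mulVecLin :=
    mem_range_transpose_of_forall fun x hx => by
      rw [← dotProduct_mulVec_eq_transpose]
      exact hy _ ⟨x, hx, rfl⟩
  have hN : A + B * vecMulVec (-(y ⬝ᵥ B *ᵥ u)⁻¹ • u) v * C =
      A + vecMulVec (-(y ⬝ᵥ B *ᵥ u)⁻¹ • B *ᵥ u) (Aᵀ *ᵥ y) := by
    rw [mul_vecMulVec, vecMulVec_mul, mulVec_smul, ← hv, mulVecLin_apply, mulVec_transpose]
  refine ⟨-(y ⬝ᵥ B *ᵥ u)⁻¹ • u, v, ?_⟩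
  rw [hN]
  rw [mulVecLin_apply, mulVecLin_apply] at hx
  refine Submodule.finrank_lt_finrank_of_lt (lt_of_le_of_ne
    ((range_add_vecMulVec_le _ _ _).trans (sup_le le_rfl
      ((Submodule.span_singleton_le_iff_mem _ _).2 (Submodule.smul_mem _ _ ⟨x, hx⟩)))) ?_)
  intro heq
  have hmem : B *ᵥ u ∈ LinearMap.range A.mulVecLin := ⟨x, hx⟩
  rw [← heq] at hmem
  obtain ⟨z, hz⟩ := hmem
  apply hyu
  rw [← hz, mulVecLin_apply, add_vecMulVec_mulVec, dotProduct_add, ← dotProduct_mulVec_eq_transpose,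
    dotProduct_smul, dotProduct_smul, smul_eq_mul, smul_eq_mul]
  field_simp
  ring

end Compression

/-! ### Raising the rank of X at the least cost. -/

section Attainment

variable {K : Type*} [Field K] {m n p q : Type*} [Fintype m] [Fintype n] [Fintype p] [Fintype q]

theorem add_mul_add_vecMulVec_mul (A : Matrix m n K) (B : Matrix m p K) (C : Matrix q n K)
    (X : Matrix p q K) (u : p → K) (v : q → K) :
    A + B * (X + vecMulVec u v) * C = A + B * X * C + vecMulVec (B *ᵥ u) (Cᵀ *ᵥ v) := by
  rw [Matrix.mul_add, Matrix.add_mul, mul_vecMulVec, vecMulVec_mul, mulVec_transpose, add_assoc]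

theorem exists_notMem_of_finrank_lt {V : Type*} [AddCommGroup V] [Module K V]
    [FiniteDimensional K V] {S T : Submodule K V} (h : finrank K S < finrank K T) :
    ∃ u ∈ T, u ∉ S := by
  by_contra! hle
  exact absurd (Submodule.finrank_mono (show T ≤ S from hle)) (not_le.2 h)

theorem exists_notMem_range_of_rank_lt {X : Matrix p q K} (h : X.rank < Fintype.card p) :
    ∃ u, u ∉ LinearMap.range X.mulVecLin := by
  obtain ⟨u, -, hu⟩ := exists_notMem_of_finrank_lt (S := LinearMap.range X.mulVecLin)
    (T := ⊤) (by rwa [finrank_top, finrank_fintype_fun_eq_card, ← rank_eq_finrank_range])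
  exact ⟨u, hu⟩

theorem exists_notMem_range_transpose_of_rank_lt {X : Matrix p q K}
    (h : X.rank < Fintype.card q) : ∃ v, v ∉ LinearMap.range Xᵀ.mulVecLin :=
  exists_notMem_range_of_rank_lt (by rwa [rank_transpose])

theorem range_transpose_add_vecMulVec {X : Matrix p q K} {u : p → K} (v : q → K)
    (hu : u ∉ LinearMap.range X.mulVecLin) :
    LinearMap.range (X + vecMulVec u v)ᵀ.mulVecLin =
      LinearMap.range Xᵀ.mulVecLin ⊔ Submodule.span K {v} := by
  rw [transpose_add_vecMulVec, range_add_vecMulVec v (by rwa [transpose_transpose])]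

/-- The number of vectors of `S` that are independent modulo the column space of `X`. -/
noncomputable def codimIn (S : Submodule K (p → K)) (X : Matrix p q K) : ℕ :=
  finrank K ↥(S ⊔ LinearMap.range X.mulVecLin) - X.rank

theorem rank_le_finrank_sup (S : Submodule K (p → K)) (X : Matrix p q K) :
    X.rank ≤ finrank K ↥(S ⊔ LinearMap.range X.mulVecLin) :=
  Submodule.finrank_mono le_sup_right

theorem codimIn_le_codimIn_add_one {S : Submodule K (p → K)} {X X' : Matrix p q K}
    (hr : X'.rank = X.rank + 1)
    (hle : LinearMap.range X.mulVecLin ≤ LinearMap.range X'.mulVecLin) :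
    codimIn S X ≤ codimIn S X' + 1 := by
  have h1 := Submodule.finrank_mono (sup_le_sup_left hle S)
  have h2 := rank_le_finrank_sup S X
  have h3 := rank_le_finrank_sup S X'
  unfold codimIn
  omega

theorem codimIn_eq_of_notMem_sup {S : Submodule K (p → K)} {X X' : Matrix p q K} {u : p → K}
    (hr : X'.rank = X.rank + 1)
    (hX' : LinearMap.range X'.mulVecLin = LinearMap.range X.mulVecLin ⊔ Submodule.span K {u})
    (hu : u ∉ S ⊔ LinearMap.range X.mulVecLin) : codimIn S X' = codimIn S X := by
  unfold codimIn
  rw [hX', ← sup_assoc, finrank_sup_span_singleton hu, hr, Nat.add_sub_add_right]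

theorem codimIn_eq_of_sup_eq_top {S : Submodule K (p → K)} {X : Matrix p q K}
    (h : S ⊔ LinearMap.range X.mulVecLin = ⊤) : codimIn S X = Fintype.card p - X.rank := by
  rw [codimIn, h, finrank_top, finrank_fintype_fun_eq_card]

theorem codimIn_eq_zero_of_le {S : Submodule K (p → K)} {X : Matrix p q K}
    (h : S ≤ LinearMap.range X.mulVecLin) : codimIn S X = 0 := by
  rw [codimIn, sup_eq_right.2 h, rank_eq_finrank_range, Nat.sub_self]

theorem codimIn_eq_finrank_of_disjoint {S : Submodule K (p → K)} {X : Matrix p q K}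
    (h : S ⊓ LinearMap.range X.mulVecLin = ⊥) : codimIn S X = finrank K S := by
  have h1 := Submodule.finrank_sup_add_finrank_inf_eq S (LinearMap.range X.mulVecLin)
  rw [h, finrank_bot, add_zero, ← rank_eq_finrank_range] at h1
  rw [codimIn, h1, Nat.add_sub_cancel]

/-- Raising the rank of `X` by `j` raises a rank-like function `f` only by the number of steps
that cannot be taken along `S` or `T`, the directions in which `f` does not increase. -/
theorem exists_rank_eq_add_of_free_directions (f : Matrix p q K → ℕ) (S : Submodule K (p → K))
    (T : Submodule K (q → K))
    (hS : ∀ X u v, u ∈ S → f (X + vecMulVec u v) ≤ f X)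
    (hT : ∀ X u v, v ∈ T → f (X + vecMulVec u v) ≤ f X)
    (hf : ∀ X u v, f (X + vecMulVec u v) ≤ f X + 1) :
    ∀ (j : ℕ) (X : Matrix p q K), X.rank + j ≤ Fintype.card p → X.rank + j ≤ Fintype.card q →
      ∃ X' : Matrix p q K, X'.rank = X.rank + j ∧
        f X' ≤ f X + (j - (codimIn S X + codimIn T Xᵀ)) := by
  intro j
  induction j with
  | zero => exact fun X _ _ => ⟨X, rfl, Nat.le_add_right _ _⟩
  | succ j ih =>
    intro X hp hq
    suffices h : ∃ u v, u ∉ LinearMap.range X.mulVecLin ∧ v ∉ LinearMap.range Xᵀ.mulVecLin ∧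
        f (X + vecMulVec u v) + (j - (codimIn S (X + vecMulVec u v) +
          codimIn T (X + vecMulVec u v)ᵀ)) ≤ f X + (j + 1 - (codimIn S X + codimIn T Xᵀ)) by
      obtain ⟨u, v, hu, hv, h⟩ := h
      have hr := rank_add_vecMulVec hu hv
      obtain ⟨X', hr', hf'⟩ := ih (X + vecMulVec u v) (by omega) (by omega)
      exact ⟨X', by omega, hf'.trans h⟩
    obtain ⟨u₀, hu₀⟩ := exists_notMem_range_of_rank_lt (X := X) (by omega)
    obtain ⟨v₀, hv₀⟩ := exists_notMem_range_transpose_of_rank_lt (X := X) (by omega)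
    have step : ∀ {u v}, u ∉ LinearMap.range X.mulVecLin → v ∉ LinearMap.range Xᵀ.mulVecLin →
        (X + vecMulVec u v).rank = X.rank + 1 ∧ (X + vecMulVec u v)ᵀ.rank = Xᵀ.rank + 1 ∧
        codimIn S X ≤ codimIn S (X + vecMulVec u v) + 1 ∧
        codimIn T Xᵀ ≤ codimIn T (X + vecMulVec u v)ᵀ + 1 := fun {u v} hu hv => by
      have hr := rank_add_vecMulVec hu hv
      have hr' : (X + vecMulVec u v)ᵀ.rank = Xᵀ.rank + 1 := by
        rw [rank_transpose, rank_transpose, hr]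
      exact ⟨hr, hr',
        codimIn_le_codimIn_add_one hr ((range_add_vecMulVec u hv).symm ▸ le_sup_left),
        codimIn_le_codimIn_add_one hr' ((range_transpose_add_vecMulVec v hu).symm ▸ le_sup_left)⟩
    -- Greedy choice: a step is paid for by `S` or by `T`, and it should not use up both at once.
    by_cases hTX : T ≤ LinearMap.range Xᵀ.mulVecLin
    · have hT0 := codimIn_eq_zero_of_le hTX
      by_cases hSX : S ≤ LinearMap.range X.mulVecLin
      · have hS0 := codimIn_eq_zero_of_le hSX
        have := hf X u₀ v₀
        exact ⟨u₀, v₀, hu₀, hv₀, by omega⟩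
      · obtain ⟨u, huS, hu⟩ := SetLike.not_le_iff_exists.1 hSX
        have := hS X u v₀ huS
        have := step hu hv₀
        exact ⟨u, v₀, hu, hv₀, by omega⟩
    · obtain ⟨v, hvT, hv⟩ := SetLike.not_le_iff_exists.1 hTX
      by_cases hSX : S ≤ LinearMap.range X.mulVecLin
      · have hS0 := codimIn_eq_zero_of_le hSX
        have := hT X u₀ v hvT
        have := step hu₀ hv
        exact ⟨u₀, v, hu₀, hv, by omega⟩
      · obtain ⟨u, huS, hu⟩ := SetLike.not_le_iff_exists.1 hSX
        -- If this sum is everything, `T` alone can pay for all remaining steps. Otherwise pay with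
        -- `u` from `S` and take `w` outside the sum, which leaves the supply in `T` intact.
        by_cases htop : T ⊔ LinearMap.range Xᵀ.mulVecLin = ⊤
        · have h1 := codimIn_eq_of_sup_eq_top htop
          have h2 : codimIn T (X + vecMulVec u₀ v)ᵀ = _ := codimIn_eq_of_sup_eq_top
            (top_le_iff.1 (htop.symm.le.trans (sup_le_sup_left
              ((range_transpose_add_vecMulVec v hu₀).symm ▸ le_sup_left) T)))
          have := hT X u₀ v hvT
          have := step hu₀ hv
          have := rank_transpose X
          exact ⟨u₀, v, hu₀, hv, by omega⟩
        · obtain ⟨w, -, hw⟩ := SetLike.not_le_iff_exists.1 (mt top_le_iff.1 htop)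
          have hw' : w ∉ LinearMap.range Xᵀ.mulVecLin := fun h => hw (Submodule.mem_sup_right h)
          have h1 := step hu hw'
          have h2 := codimIn_eq_of_notMem_sup h1.2.1 (range_transpose_add_vecMulVec w hu) hw
          have := hS X u w huS
          exact ⟨u, w, hu, hw', by omega⟩

/-! ### Attaining the minimum. -/

/-- Since range A ⊆ range N + range BX, a drop by the full r(X) forces r[N, BX] ≥ r(N) + r(X). Hence
`B` is injective on range X modulo range N. Consequently the optimal descent uses up no free
direction. -/
theorem comap_range_inf_range_eq_bot {A : Matrix m n K} {B : Matrix m p K} {C : Matrix q n K}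
    {X : Matrix p q K} (h : A.rank = (A + B * X * C).rank + X.rank) :
    (LinearMap.range (A + B * X * C).mulVecLin).comap B.mulVecLin ⊓
      LinearMap.range X.mulVecLin = ⊥ := by
  have h1 := rank_fromCols_add_finrank_comap (A + B * X * C) (B * X)
  have h2 : A.rank ≤ (fromCols (A + B * X * C) (B * X)).rank := by
    refine Submodule.finrank_mono ?_
    rw [range_fromCols]
    rintro _ ⟨x, rfl⟩
    have hA : A *ᵥ x = (A + B * X * C) *ᵥ x + (B * X) *ᵥ (-(C *ᵥ x)) := by
      rw [mulVec_neg, mulVec_mulVec, add_mulVec, add_neg_cancel_right]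
    rw [mulVecLin_apply, hA]
    exact Submodule.add_mem_sup ⟨_, rfl⟩ ⟨_, rfl⟩
  have h3 := X.mulVecLin.finrank_range_add_finrank_ker
  rw [finrank_fintype_fun_eq_card, ← rank_eq_finrank_range] at h3
  have h4 : LinearMap.ker X.mulVecLin =
      (LinearMap.range (A + B * X * C).mulVecLin).comap (B * X).mulVecLin := by
    refine Submodule.eq_of_le_of_finrank_le ?_ (by omega)
    rw [mulVecLin_mul, Submodule.comap_comp]
    exact LinearMap.ker_le_comap _
  refine (Submodule.eq_bot_iff _).2 ?_
  rintro _ ⟨hz, z, rfl⟩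
  have hz' : z ∈ LinearMap.ker X.mulVecLin := by
    rw [h4, mulVecLin_mul, Submodule.comap_comp]
    exact hz
  exact hz'

theorem freeDirections_inf_range_eq_bot {A : Matrix m n K} {B : Matrix m p K} {C : Matrix q n K}
    {X : Matrix p q K} (h : A.rank = (A + B * X * C).rank + X.rank) :
    freeDirections A B C ⊓ LinearMap.range X.mulVecLin = ⊥ := by
  refine le_bot_iff.1 (le_trans (inf_le_inf_right _ ?_) (comap_range_inf_range_eq_bot h).le)
  rw [← freeDirections_add_mul_mul A B C X]
  exact freeDirections_le_comap_range _ _ _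

theorem exists_rank_le_and_rank_add_le (A : Matrix m n K) (B : Matrix m p K)
    (C : Matrix q n K) (k : ℕ)
    (hk : (fromCols A B).rank + (fromRows A C).rank + k ≤ A.rank + (fromBlocks A B C 0).rank) :
    ∃ X : Matrix p q K, X.rank ≤ k ∧ (A + B * X * C).rank + k ≤ A.rank := by
  induction k with
  | zero => exact ⟨0, by simp, by simp⟩
  | succ k ih =>
    obtain ⟨X, hX, hr⟩ := ih (by omega)
    by_cases hlt : (A + B * X * C).rank + k < A.rank
    · exact ⟨X, by omega, by omega⟩
    obtain ⟨u, v, huv⟩ := exists_rank_add_vecMulVec_lt (A := A + B * X * C) (B := B) (C := C) (by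
      rw [rank_fromCols_add_mul_mul, rank_fromRows_add_mul_mul, rank_fromBlocks_add_mul_mul]
      omega)
    refine ⟨X + vecMulVec u v, (rank_add_vecMulVec_le _ _ _).trans (by omega), ?_⟩
    rw [Matrix.mul_add, Matrix.add_mul, ← add_assoc A]
    omega

theorem exists_rank_eq_and_rank_le (A : Matrix m n K) (B : Matrix m p K) (C : Matrix q n K)
    {t : ℕ} (hp : t ≤ Fintype.card p) (hq : t ≤ Fintype.card q) :
    ∃ X : Matrix p q K, X.rank = t ∧
      ((A + B * X * C).rank + t ≤ A.rank ∨
        (A + B * X * C).rank + (fromBlocks A B C 0).rank ≤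
          (fromCols A B).rank + (fromRows A C).rank ∨
        (A + B * X * C).rank + A.rank + Fintype.card p + Fintype.card q ≤
          (fromCols A B).rank + (fromRows A C).rank + t) := by
  have hM := rank_fromCols_add_rank_fromRows_le A B C
  obtain ⟨k, hkt, hk, hkmax⟩ : ∃ k ≤ t,
      (fromCols A B).rank + (fromRows A C).rank + k ≤ A.rank + (fromBlocks A B C 0).rank ∧
      (k = t ∨ (fromCols A B).rank + (fromRows A C).rank + k =
        A.rank + (fromBlocks A B C 0).rank) :=
    -- The number of rank-lowering steps: `t`, or fewer if the bound r(G) + r(H) - r(M) is met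
    -- earlier.
    ⟨min t (A.rank + (fromBlocks A B C 0).rank - ((fromCols A B).rank + (fromRows A C).rank)),
      by omega, by omega, by omega⟩
  obtain ⟨X, hX, hr⟩ := exists_rank_le_and_rank_add_le A B C k hk
  -- Rank cannot drop by more than r(X), so r(X) = k and the drop is exactly k.
  have hle := rank_le_rank_add_mul_mul_add A B C X
  have hdS : codimIn (freeDirections A B C) X = _ := codimIn_eq_finrank_of_disjoint
    (freeDirections_inf_range_eq_bot (by omega))
  have hdT : codimIn (freeDirections Aᵀ Cᵀ Bᵀ) Xᵀ = _ := codimIn_eq_finrank_of_disjoint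
    (freeDirections_inf_range_eq_bot (by
      rw [← add_mul_mul_transpose, rank_transpose, rank_transpose, rank_transpose]
      omega))
  have hdS' := rank_fromBlocks_add_finrank_freeDirections A B C
  have hdT' := rank_fromBlocks_add_finrank_freeDirections_transpose A B C
  obtain ⟨X', hX', hr'⟩ := exists_rank_eq_add_of_free_directions
    (fun X => (A + B * X * C).rank) (freeDirections A B C) (freeDirections Aᵀ Cᵀ Bᵀ)
    (fun X u v hu => by
      simp only [add_mul_add_vecMulVec_mul]
      refine rank_add_vecMulVec_le_of_mem ?_
      rw [← freeDirections_add_mul_mul A B C X] at hu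
      exact freeDirections_le_comap_range _ _ _ hu)
    (fun X u v hv => by
      simp only [add_mul_add_vecMulVec_mul]
      refine rank_add_vecMulVec_le_of_mem_transpose ?_
      rw [← freeDirections_add_mul_mul Aᵀ Cᵀ Bᵀ Xᵀ, ← add_mul_mul_transpose] at hv
      exact freeDirections_le_comap_range _ _ _ hv)
    (fun X u v => by
      simp only [add_mul_add_vecMulVec_mul]
      exact rank_add_vecMulVec_le _ _ _)
    (t - k) X (by omega) (by omega)
  exact ⟨X', by omega, by omega⟩

/-! ### Attaining the maximum. -/

theorem exists_mulVec_notMem_range {A : Matrix m n K} {B : Matrix m p K}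
    (h : A.rank < (fromCols A B).rank) : ∃ u, B *ᵥ u ∉ LinearMap.range A.mulVecLin := by
  by_contra! hle
  refine absurd (Submodule.finrank_mono ?_) (not_le.2 h)
  rw [range_fromCols]
  refine sup_le le_rfl ?_
  rintro _ ⟨u, rfl⟩
  exact hle u

theorem exists_rank_le_and_add_le_rank (A : Matrix m n K) (B : Matrix m p K)
    (C : Matrix q n K) (k : ℕ) (hG : A.rank + k ≤ (fromCols A B).rank)
    (hH : A.rank + k ≤ (fromRows A C).rank) :
    ∃ X : Matrix p q K, X.rank ≤ k ∧ A.rank + k ≤ (A + B * X * C).rank := by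
  induction k with
  | zero => exact ⟨0, by simp, by simp⟩
  | succ k ih =>
    obtain ⟨X, hX, hr⟩ := ih (by omega) (by omega)
    by_cases hlt : A.rank + k < (A + B * X * C).rank
    · exact ⟨X, by omega, by omega⟩
    have hB : ∃ u, B *ᵥ u ∉ LinearMap.range (A + B * X * C).mulVecLin :=
      exists_mulVec_notMem_range (by rw [rank_fromCols_add_mul_mul]; omega)
    have hC : ∃ v, Cᵀ *ᵥ v ∉ LinearMap.range (A + B * X * C)ᵀ.mulVecLin :=
      exists_mulVec_notMem_range (by
        rw [rank_fromCols_transpose, rank_fromRows_add_mul_mul, rank_transpose]; omega)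
    obtain ⟨u, hu⟩ := hB
    obtain ⟨v, hv⟩ := hC
    refine ⟨X + vecMulVec u v, (rank_add_vecMulVec_le _ _ _).trans (by omega), ?_⟩
    rw [add_mul_add_vecMulVec_mul, rank_add_vecMulVec hu hv]
    omega

theorem exists_rank_eq_add_and_rank_le [CharZero K] (A : Matrix m n K) (B : Matrix m p K)
    (C : Matrix q n K) (j : ℕ) (X : Matrix p q K) (hp : X.rank + j ≤ Fintype.card p)
    (hq : X.rank + j ≤ Fintype.card q) :
    ∃ X' : Matrix p q K, X'.rank = X.rank + j ∧ (A + B * X * C).rank ≤ (A + B * X' * C).rank := by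
  induction j with
  | zero => exact ⟨X, rfl, le_rfl⟩
  | succ j ih =>
    obtain ⟨X', hX', hr⟩ := ih (by omega) (by omega)
    obtain ⟨u, hu⟩ := exists_notMem_range_of_rank_lt (X := X') (by omega)
    obtain ⟨v, hv⟩ := exists_notMem_range_transpose_of_rank_lt (X := X') (by omega)
    obtain ⟨c, hc, hle⟩ :=
      exists_smul_rank_le_rank_add_vecMulVec (A + B * X' * C) (B *ᵥ u) (Cᵀ *ᵥ v)
    refine ⟨X' + vecMulVec (c • u) v, ?_, ?_⟩
    · rw [rank_add_vecMulVec (fun h => hu ((Submodule.smul_mem_iff _ hc).1 h)) hv]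
      omega
    · rw [add_mul_add_vecMulVec_mul, mulVec_smul]
      exact hr.trans hle

theorem exists_rank_eq_and_le_rank [CharZero K] (A : Matrix m n K) (B : Matrix m p K)
    (C : Matrix q n K) {t : ℕ} (hp : t ≤ Fintype.card p) (hq : t ≤ Fintype.card q) :
    ∃ X : Matrix p q K, X.rank = t ∧
      ((fromCols A B).rank ≤ (A + B * X * C).rank ∨
        (fromRows A C).rank ≤ (A + B * X * C).rank ∨ A.rank + t ≤ (A + B * X * C).rank) := by
  have hG := rank_le_rank_fromCols A B
  have hH := rank_le_rank_fromRows A C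
  obtain ⟨k, hkt, hkG, hkH, hk⟩ : ∃ k ≤ t, A.rank + k ≤ (fromCols A B).rank ∧
      A.rank + k ≤ (fromRows A C).rank ∧ (k = t ∨ A.rank + k = (fromCols A B).rank ∨
        A.rank + k = (fromRows A C).rank) :=
    ⟨min t (min ((fromCols A B).rank - A.rank) ((fromRows A C).rank - A.rank)),
      by omega, by omega, by omega, by omega⟩
  obtain ⟨X, hX, hr⟩ := exists_rank_le_and_add_le_rank A B C k hkG hkH
  obtain ⟨X', hX', hr'⟩ := exists_rank_eq_add_and_rank_le A B C (t - X.rank) X (by omega) (by omega)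
  exact ⟨X', by omega, by omega⟩

/-! ### Full-rank factorization and conclusion. -/

/-- The columns of `Y` form a basis of the column space of `X`; `Z` holds the coordinates of the
columns of `X`. -/
theorem exists_eq_mul_of_rank_eq {t : ℕ} {X : Matrix p q K} (h : X.rank = t) :
    ∃ (Y : Matrix p (Fin t) K) (Z : Matrix (Fin t) q K), Y.rank = t ∧ Z.rank = t ∧ X = Y * Z := by
  classical
  let b : Basis (Fin t) K (LinearMap.range X.mulVecLin) := finBasisOfFinrankEq K _ h
  let x : q → LinearMap.range X.mulVecLin := fun j => ⟨X.mulVecLin (Pi.single j 1), ⟨_, rfl⟩⟩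
  let Y : Matrix p (Fin t) K := of fun i k => (b k : p → K) i
  let Z : Matrix (Fin t) q K := of fun k j => b.repr (x j) k
  have hX : X = Y * Z := by
    ext i j
    have h1 := congrArg (fun w : LinearMap.range X.mulVecLin => (w : p → K) i) (b.sum_repr (x j))
    simp only [Submodule.coe_sum, Submodule.coe_smul, Finset.sum_apply, Pi.smul_apply,
      smul_eq_mul] at h1
    rw [mul_apply]
    simp only [Y, Z, of_apply]
    rw [← (by simp [x] : (x j : p → K) i = X i j), ← h1]
    exact Finset.sum_congr rfl fun k _ => mul_comm _ _
  have hY := rank_mul_le_left Y Z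
  have hZ := rank_mul_le_right Y Z
  rw [← hX, h] at hY hZ
  exact ⟨Y, Z, le_antisymm (by simpa using rank_le_card_width Y) hY,
    le_antisymm (by simpa using rank_le_card_height Z) hZ, hX⟩

end Attainment

/-- The maximum and the minimum are attained. Values are integers, so the subtractions are
not truncated. -/
theorem corollary3p2 (m n p q t : ℕ) (ht : t ≤ min p q)
    (A : Matrix (Fin m) (Fin n) ℂ) (B : Matrix (Fin m) (Fin p) ℂ)
    (C : Matrix (Fin q) (Fin n) ℂ) :
    IsGreatest (factoredRankValues A B C t)
      (min ((blockG A B).rank : ℤ) (min ((blockH A C).rank : ℤ) ((A.rank : ℤ) + (t : ℤ)))) ∧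
    IsLeast (factoredRankValues A B C t)
      (max (((blockG A B).rank : ℤ) + ((blockH A C).rank : ℤ) - ((blockM A B C).rank : ℤ))
        (max (((blockG A B).rank : ℤ) + ((blockH A C).rank : ℤ) - (A.rank : ℤ) + (t : ℤ)
            - (p : ℤ) - (q : ℤ))
          ((A.rank : ℤ) - (t : ℤ)))) := by
  have hp : t ≤ Fintype.card (Fin p) := by rw [Fintype.card_fin]; omega
  have hq : t ≤ Fintype.card (Fin q) := by rw [Fintype.card_fin]; omega
  have upper : ∀ X : Matrix (Fin p) (Fin q) ℂ, X.rank ≤ t →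
      (A + B * X * C).rank ≤ (fromCols A B).rank ∧ (A + B * X * C).rank ≤ (fromRows A C).rank ∧
      (A + B * X * C).rank ≤ A.rank + t := fun X hX =>
    ⟨(rank_le_rank_fromCols _ B).trans (rank_fromCols_add_mul_mul A B C X).le,
      (rank_le_rank_fromRows _ C).trans (rank_fromRows_add_mul_mul A B C X).le,
      (rank_add_mul_mul_le A B C X).trans (by omega)⟩
  have lower : ∀ (Y : Matrix (Fin p) (Fin t) ℂ) (Z : Matrix (Fin t) (Fin q) ℂ),
      Y.rank = t → Z.rank = t →
      (fromCols A B).rank + (fromRows A C).rank ≤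
        (A + B * Y * Z * C).rank + (fromBlocks A B C 0).rank ∧
      (fromCols A B).rank + (fromRows A C).rank + t ≤
        (A + B * Y * Z * C).rank + A.rank + p + q ∧
      A.rank ≤ (A + B * Y * Z * C).rank + t := fun Y Z hY hZ => by
    -- Apply the inequality to the updated matrix, then return to `A` in the three invariant ranks.
    have h1 := rank_fromCols_add_rank_fromRows_le (A + B * (Y * Z) * C) B C
    rw [rank_fromCols_add_mul_mul, rank_fromRows_add_mul_mul, rank_fromBlocks_add_mul_mul] at h1
    have h2 := rank_fromCols_add_rank_fromRows_add_le A B C (Y := Y) (Z := Z)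
      (by rwa [Fintype.card_fin]) (by rwa [Fintype.card_fin])
    have h3 := rank_le_rank_add_mul_mul_add A B C (Y * Z)
    have h4 := rank_mul_le_left Y Z
    rw [← Matrix.mul_assoc] at h1 h3
    simp only [Fintype.card_fin] at h2
    omega
  unfold blockG blockH blockM
  refine ⟨⟨?_, ?_⟩, ⟨?_, ?_⟩⟩
  · obtain ⟨X, hX, hr⟩ := exists_rank_eq_and_le_rank A B C hp hq
    have hu := upper X hX.le
    obtain ⟨Y, Z, hY, hZ, rfl⟩ := exists_eq_mul_of_rank_eq hX
    refine ⟨Y, hY, Z, hZ, ?_⟩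
    rw [← Matrix.mul_assoc] at hr hu
    omega
  · rintro _ ⟨Y, hY, Z, hZ, rfl⟩
    have hY' : Y.rank = t := hY
    have hu := upper (Y * Z) ((rank_mul_le_left Y Z).trans hY'.le)
    rw [← Matrix.mul_assoc] at hu
    omega
  · obtain ⟨X, hX, hr⟩ := exists_rank_eq_and_rank_le A B C hp hq
    obtain ⟨Y, Z, hY, hZ, rfl⟩ := exists_eq_mul_of_rank_eq hX
    refine ⟨Y, hY, Z, hZ, ?_⟩
    have hl := lower Y Z hY hZ
    rw [← Matrix.mul_assoc] at hr
    simp only [Fintype.card_fin] at hr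
    omega
  · rintro _ ⟨Y, hY, Z, hZ, rfl⟩
    have hl := lower Y Z hY hZ
    omega
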